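/- Let $A\in\mathbb{R}^{n\times n}$ be symmetric positive definite (SPD), and let $S\in\mathbb{R}^{n\times n_s}$ and $P\in\mathbb{R}^{n\times n_c}$ be of full column rank, where $\max\{n_s,n_c\}<n\le n_s+n_c$ and $\operatorname{rank}(S\ P)=n$. Put $A_s=S^TAS$ and $A_c=P^TAP$. Let $M_s\in\mathbb{R}^{n_s\times n_s}$ be nonsingular with $M_s+M_s^T-A_s$ SPD, and let $B_c\in\mathbb{R}^{n_c\times n_c}$ be SPD. Define $$\widetilde M_s=M_s^T(M_s+M_s^T-A_s)^{-1}M_s,\qquad \Pi_A=PA_c^{-1}P^TA,$$ $$\widetilde E_{TL}=(I-SM_s^{-T}S^TA)(I-PB_c^{-1}P^TA)(I-SM_s^{-1}S^TA),$$ the latter being the iteration matrix of the two-level hierarchical basis method with (inexact) coarse solver $B_c$. For $v\in\mathbb{R}^n$ and $B\in\mathbb{R}^{n\times n}$ let $\|v\|_A=\sqrt{v^TAv}$ and $\|B\|_A=\max_{v\ne0}\|Bv\|_A/\|v\|_A$. Write $\lambda_{\min}$, $\lambda_{\max}$, $\lambda^+_{\min}$ for the smallest, the largest and the smallest positive eigenvalue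 of a matrix, and set $$\alpha=\lambda_{\min}(B_c^{-1}A_c),\quad \beta=\lambda_{\max}(B_c^{-1}A_c),\quad \sigma=\lambda^+_{\min}\big(S\widetilde M_s^{-1}S^TA(I-\Pi_A)\big),$$ $$\Lambda=\lambda_{\max}(\widetilde M_s^{-1}A_s),\quad \kappa=\lambda^+_{\min}\big(S\widetilde M_s^{-1}S^TA\Pi_A\big),$$ where $\kappa$ is used only in case (i). All these eigenvalues, and the maximum defining $\|\widetilde E_{TL}\|_A$, exist (for $\kappa$: in case (i)), and the following holds. (i) If $\operatorname{rank}(S^TAP)=n_c$, then $L_1\le\|\widetilde E_{TL}\|_A\le U_1$, where $$L_1=\begin{cases}1-\min\{\beta-\beta\kappa,\ \sigma\}&\text{if }\beta\le1,\\ 1-\min\{\Lambda,\ \beta\sigma\}&\text{if }\alpha\le1<\beta,\\ \max\{\alpha-1-\alpha\kappa,\ 1-\Lambda,\ (\alpha-1)(1-\Lambda),\ 1-\beta\sigma\}&\text{if }1<\alpha,\end{cases}$$ $$U_1=\begin{cases}1-\alpha\sigma&\text{if }\beta\le1,\\ \max\{1-\alpha\sigma,\ (\beta-1)(1-\kappa)\}&\text{if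 }\alpha\le1<\beta,\\ \max\{1-\sigma,\ (\beta-1)(1-\kappa)\}&\text{if }1<\alpha.\end{cases}$$ (ii) If $\operatorname{rank}(S^TAP)<n_c$, then $L_2\le\|\widetilde E_{TL}\|_A\le U_2$, where $$L_2=\begin{cases}1-\min\{\beta,\ \sigma\}&\text{if }\beta\le1,\\ 1-\min\{\Lambda,\ \beta\sigma\}&\text{if }\alpha\le1<\beta,\\ \max\{\alpha-1,\ 1-\Lambda,\ 1-\beta\sigma\}&\text{if }1<\alpha,\end{cases}$$ $$U_2=\begin{cases}1-\alpha\sigma&\text{if }\beta\le1,\\ \max\{1-\alpha\sigma,\ \beta-1\}&\text{if }\alpha\le1<\beta,\\ \max\{1-\sigma,\ \beta-1\}&\text{if }1<\alpha.\end{cases}$$ -/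

import Mathlib

open Matrix

namespace TLHB

/-- The smallest (real) eigenvalue of a real square matrix. -/
noncomputable def lamMin {m : ℕ} (X : Matrix (Fin m) (Fin m) ℝ) : ℝ :=
  sInf (spectrum ℝ X)

/-- The largest (real) eigenvalue of a real square matrix. -/
noncomputable def lamMax {m : ℕ} (X : Matrix (Fin m) (Fin m) ℝ) : ℝ :=
  sSup (spectrum ℝ X)

/-- The set of positive eigenvalues of a real square matrix. -/
def posSpectrum {m : ℕ} (X : Matrix (Fin m) (Fin m) ℝ) : Set ℝ :=
  {t | t ∈ spectrum ℝ X ∧ 0 < t}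

/-- The smallest positive eigenvalue of a real square matrix. -/
noncomputable def lamMinPos {m : ℕ} (X : Matrix (Fin m) (Fin m) ℝ) : ℝ :=
  sInf (posSpectrum X)

/-- The energy norm of a vector, `‖v‖_A = √(vᵀ A v)`. -/
noncomputable def energyNorm {n : ℕ} (A : Matrix (Fin n) (Fin n) ℝ) (v : Fin n → ℝ) : ℝ :=
  Real.sqrt (v ⬝ᵥ (A *ᵥ v))

/-- The set of all quotients `‖B v‖_A / ‖v‖_A` with `v ≠ 0`. -/
noncomputable def energyQuotients {n : ℕ} (A B : Matrix (Fin n) (Fin n) ℝ) : Set ℝ :=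
  {q | ∃ v : Fin n → ℝ, v ≠ 0 ∧ q = energyNorm A (B *ᵥ v) / energyNorm A v}

/-- The energy norm of a matrix, `‖B‖_A = max_{v ≠ 0} ‖B v‖_A / ‖v‖_A`. -/
noncomputable def energyOpNorm {n : ℕ} (A B : Matrix (Fin n) (Fin n) ℝ) : ℝ :=
  sSup (energyQuotients A B)

/-- The Galerkin matrix `Xᵀ A X`: `A_s` for `X = S`, and `A_c` for `X = P`. -/
def galerkin {n k : ℕ} (A : Matrix (Fin n) (Fin n) ℝ) (X : Matrix (Fin n) (Fin k) ℝ) :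
    Matrix (Fin k) (Fin k) ℝ :=
  Xᵀ * A * X

/-- The symmetrized smoother `M̃_s = M_sᵀ (M_s + M_sᵀ - A_s)⁻¹ M_s`. -/
noncomputable def smoother {n ns : ℕ} (A : Matrix (Fin n) (Fin n) ℝ)
    (S : Matrix (Fin n) (Fin ns) ℝ) (Ms : Matrix (Fin ns) (Fin ns) ℝ) :
    Matrix (Fin ns) (Fin ns) ℝ :=
  Msᵀ * (Ms + Msᵀ - galerkin A S)⁻¹ * Ms

/-- The `A`-orthogonal projection `Π_A = P A_c⁻¹ Pᵀ A` onto the coarse space. -/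
noncomputable def coarseProj {n nc : ℕ} (A : Matrix (Fin n) (Fin n) ℝ)
    (P : Matrix (Fin n) (Fin nc) ℝ) : Matrix (Fin n) (Fin n) ℝ :=
  P * (galerkin A P)⁻¹ * Pᵀ * A

/-- The matrix `S M̃_s⁻¹ Sᵀ A`. -/
noncomputable def smoothOp {n ns : ℕ} (A : Matrix (Fin n) (Fin n) ℝ)
    (S : Matrix (Fin n) (Fin ns) ℝ) (Ms : Matrix (Fin ns) (Fin ns) ℝ) :
    Matrix (Fin n) (Fin n) ℝ :=
  S * (smoother A S Ms)⁻¹ * Sᵀ * A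

/-- The iteration (error propagation) matrix of the two-level hierarchical basis method
with coarse solver `B_c`:
`Ẽ_TL = (I - S M_s⁻ᵀ Sᵀ A)(I - P B_c⁻¹ Pᵀ A)(I - S M_s⁻¹ Sᵀ A)`. -/
noncomputable def iterMatrix {n ns nc : ℕ} (A : Matrix (Fin n) (Fin n) ℝ)
    (S : Matrix (Fin n) (Fin ns) ℝ) (P : Matrix (Fin n) (Fin nc) ℝ)
    (Ms : Matrix (Fin ns) (Fin ns) ℝ) (Bc : Matrix (Fin nc) (Fin nc) ℝ) :
    Matrix (Fin n) (Fin n) ℝ :=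
  (1 - S * (Ms⁻¹)ᵀ * Sᵀ * A) * (1 - P * Bc⁻¹ * Pᵀ * A) * (1 - S * Ms⁻¹ * Sᵀ * A)

/-- One sweep of the two-level hierarchical basis method for `A u = f`, started at `u₀`. -/
noncomputable def sweep {n ns nc : ℕ} (A : Matrix (Fin n) (Fin n) ℝ)
    (S : Matrix (Fin n) (Fin ns) ℝ) (P : Matrix (Fin n) (Fin nc) ℝ)
    (Ms : Matrix (Fin ns) (Fin ns) ℝ) (Bc : Matrix (Fin nc) (Fin nc) ℝ)
    (f u₀ : Fin n → ℝ) : Fin n → ℝ :=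
  let u₁ := u₀ + (S * Ms⁻¹ * Sᵀ) *ᵥ (f - A *ᵥ u₀)
  let u₂ := u₁ + P *ᵥ (Bc⁻¹ *ᵥ (Pᵀ *ᵥ (f - A *ᵥ u₁)))
  u₂ + (S * (Ms⁻¹)ᵀ * Sᵀ) *ᵥ (f - A *ᵥ u₂)

/-- `iterMatrix` propagates the error of the method. -/
theorem sub_sweep {n ns nc : ℕ} (A : Matrix (Fin n) (Fin n) ℝ)
    (S : Matrix (Fin n) (Fin ns) ℝ) (P : Matrix (Fin n) (Fin nc) ℝ)
    (Ms : Matrix (Fin ns) (Fin ns) ℝ) (Bc : Matrix (Fin nc) (Fin nc) ℝ)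
    (u u₀ : Fin n → ℝ) :
    u - sweep A S P Ms Bc (A *ᵥ u) u₀ = iterMatrix A S P Ms Bc *ᵥ (u - u₀) := by
  have key : ∀ (X : Matrix (Fin n) (Fin n) ℝ) (w : Fin n → ℝ),
      u - (w + X *ᵥ (A *ᵥ u - A *ᵥ w)) = (1 - X * A) *ᵥ (u - w) := by
    intro X w
    rw [← Matrix.mulVec_sub, Matrix.sub_mulVec, Matrix.one_mulVec, Matrix.mulVec_mulVec]
    abel
  unfold sweep iterMatrix
  simp only [Matrix.mulVec_mulVec _ Bc⁻¹,
    Matrix.mulVec_mulVec _ P, ← Matrix.mul_assoc]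
  rw [key, key, key, Matrix.mulVec_mulVec, Matrix.mulVec_mulVec]

end TLHB

/-! Let `T = 1 - S Ms⁻¹ Sᵀ A`, with `A`-adjoint `T'`, and let `Q` be the `A`-orthogonal projection
onto the range of `P`. The iteration matrix is `T' (1 - P Bc⁻¹ Pᵀ A) T`, which is `A`-self-adjoint,
so its energy norm is its numerical radius: the maximum of `|t - k| / q`, where `q = ‖v‖²`, `t = ‖T
v‖²` and `k` is the energy form of `P Bc⁻¹ Pᵀ A` at `T v`. With `p = ‖Q T v‖²`, the spectrum of
`Bc⁻¹ A_c` gives `α p ≤ k ≤ β p`.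

Since `T T' = 1 - R` with `R = smoothOp A S Ms`, a projection `D` satisfies `‖D T‖² = ‖T' D‖² = 1 -
c`, where `c` is the minimum of the Rayleigh quotient of `R` on the range of `D`, that is, the least
positive eigenvalue of `R D` (`exists_isLeast_posSpectrum`). Taking `D = 1 - Q` and `D = Q` yields
the sharp bounds `t - p ≤ (1 - σ) q` and `p ≤ (1 - κ) q`; in the rank-deficient case `‖Q T‖ = 1`,
and 0 takes the place of `κ`.

The rest is scalar arithmetic (`two_level_bounds`). Lower bounds test extremal vectors, a vector
fixed by `T`, and `T`-preimages (`exists_preimage`) of vectors in the kernel and the range of `Q`.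
-/

namespace TLHB

/-- The bilinear form `xᵀ A y`. -/
def form {k : ℕ} (A : Matrix (Fin k) (Fin k) ℝ) (x y : Fin k → ℝ) : ℝ := x ⬝ᵥ (A *ᵥ y)

/-! ### Energy forms, Rayleigh quotients and spectra -/

section form

variable {k l : ℕ} (A : Matrix (Fin k) (Fin k) ℝ)

theorem form_add_left (x y z : Fin k → ℝ) : form A (x + y) z = form A x z + form A y z := by
  simp [form, add_dotProduct]

theorem form_add_right (x y z : Fin k → ℝ) : form A x (y + z) = form A x y + form A x z := by
  simp [form, mulVec_add, dotProduct_add]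

theorem form_sub_left (x y z : Fin k → ℝ) : form A (x - y) z = form A x z - form A y z := by
  simp [form, sub_dotProduct]

theorem form_sub_right (x y z : Fin k → ℝ) : form A x (y - z) = form A x y - form A x z := by
  simp [form, mulVec_sub, dotProduct_sub]

theorem form_smul_left (c : ℝ) (x y : Fin k → ℝ) : form A (c • x) y = c * form A x y := by
  simp [form]

theorem form_smul_right (c : ℝ) (x y : Fin k → ℝ) : form A x (c • y) = c * form A x y := by
  simp [form, mulVec_smul]

theorem form_zero_left (x : Fin k → ℝ) : form A 0 x = 0 := by simp [form]

theorem form_zero_right (x : Fin k → ℝ) : form A x 0 = 0 := by simp [form]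

theorem form_neg_matrix (x y : Fin k → ℝ) : form (-A) x y = -form A x y := by
  simp [form, neg_mulVec]

variable {A}

theorem form_comm (hA : Aᵀ = A) (x y : Fin k → ℝ) : form A x y = form A y x := by
  unfold form
  rw [dotProduct_mulVec, dotProduct_comm, ← mulVec_transpose, hA]

theorem form_mulVec_left {M M' : Matrix (Fin k) (Fin k) ℝ} (h : Mᵀ * A = A * M')
    (x y : Fin k → ℝ) : form A (M *ᵥ x) y = form A x (M' *ᵥ y) := by
  unfold form
  rw [mulVec_mulVec, ← h, ← mulVec_mulVec, dotProduct_mulVec x, vecMul_transpose]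

theorem form_mulVec_mulVec (X : Matrix (Fin k) (Fin l) ℝ) (x y : Fin l → ℝ) :
    form A (X *ᵥ x) (X *ᵥ y) = form (galerkin A X) x y := by
  unfold form galerkin
  rw [← mulVec_mulVec, ← mulVec_mulVec, dotProduct_mulVec x, vecMul_transpose]

theorem form_sandwich (hA : Aᵀ = A) (X : Matrix (Fin k) (Fin l) ℝ)
    (M : Matrix (Fin l) (Fin l) ℝ) (x y : Fin k → ℝ) :
    form A x ((X * M * Xᵀ * A) *ᵥ y) = form M ((Xᵀ * A) *ᵥ x) ((Xᵀ * A) *ᵥ y) := by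
  unfold form
  have h : A * (X * M * Xᵀ * A) = (Xᵀ * A)ᵀ * M * (Xᵀ * A) := by
    simp [transpose_mul, hA, Matrix.mul_assoc]
  rw [mulVec_mulVec, h, ← mulVec_mulVec, ← mulVec_mulVec, dotProduct_mulVec x, vecMul_transpose]

theorem form_nonneg (hA : A.PosDef) (x : Fin k → ℝ) : 0 ≤ form A x x := by
  simpa [form] using hA.posSemidef.dotProduct_mulVec_nonneg x

theorem form_pos (hA : A.PosDef) {x : Fin k → ℝ} (hx : x ≠ 0) : 0 < form A x x := by
  simpa [form] using hA.dotProduct_mulVec_pos hx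

theorem eq_zero_of_form_nonpos (hA : A.PosDef) {x : Fin k → ℝ} (h : form A x x ≤ 0) : x = 0 := by
  by_contra hx
  exact absurd (form_pos hA hx) (not_lt.mpr h)

theorem PosDef.transpose_eq (hA : A.PosDef) : Aᵀ = A := by
  simpa [conjTranspose_eq_transpose_of_trivial] using hA.isHermitian.eq

theorem form_sq_le (hA : A.PosDef) (x y : Fin k → ℝ) :
    form A x y ^ 2 ≤ form A x x * form A y y := by
  rcases eq_or_ne y 0 with rfl | hy
  · simp [form_zero_right]
  have hyp := form_pos hA hy
  have h := form_nonneg hA (form A y y • x - form A x y • y)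
  simp only [form_sub_left, form_sub_right, form_smul_left, form_smul_right] at h
  rw [form_comm (PosDef.transpose_eq hA) y x] at h
  have h2 : 0 ≤ form A y y * (form A x x * form A y y - form A x y ^ 2) := by linarith
  linarith [nonneg_of_mul_nonneg_right h2 hyp]

theorem continuous_form (A : Matrix (Fin k) (Fin k) ℝ) : Continuous fun x => form A x x := by
  unfold form
  fun_prop

/-- The minimum of a generalized Rayleigh quotient on a nonzero subspace is attained, and a
minimizer is a critical point. -/
theorem exists_rayleigh_min {X Y : Matrix (Fin k) (Fin k) ℝ} (hX : Xᵀ = X) (hY : Y.PosDef)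
    (W : Submodule ℝ (Fin k → ℝ)) {w₀ : Fin k → ℝ} (hw₀ : w₀ ∈ W) (hw₀' : w₀ ≠ 0) :
    ∃ c : ℝ, ∃ v ∈ W, v ≠ 0 ∧ (∀ w ∈ W, c * form Y w w ≤ form X w w) ∧
      ∀ w ∈ W, form X w v = c * form Y w v := by
  have hcomp : IsCompact ((W : Set (Fin k → ℝ)) ∩ Metric.sphere 0 1) :=
    (isCompact_sphere _ _).inter_left W.closed_of_finiteDimensional
  have hnorm : ∀ w ∈ W, w ≠ 0 → ‖w‖⁻¹ • w ∈ (W : Set (Fin k → ℝ)) ∩ Metric.sphere 0 1 := by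
    intro w hw hw0
    refine ⟨W.smul_mem _ hw, ?_⟩
    simp [norm_smul, inv_mul_cancel₀ (norm_ne_zero_iff.mpr hw0)]
  have hne : ∀ w ∈ (W : Set (Fin k → ℝ)) ∩ Metric.sphere 0 1, w ≠ 0 := by
    rintro w ⟨-, hw⟩ rfl
    simp at hw
  obtain ⟨v, hv, hmin⟩ := hcomp.exists_isMinOn ⟨_, hnorm w₀ hw₀ hw₀'⟩
    (f := fun w => form X w w / form Y w w)
    ((continuous_form X).continuousOn.div (continuous_form Y).continuousOn
      fun w hw => (form_pos hY (hne w hw)).ne')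
  have hv0 := hne v hv
  set c := form X v v / form Y v v with hc
  have hle : ∀ w ∈ W, c * form Y w w ≤ form X w w := by
    intro w hw
    rcases eq_or_ne w 0 with rfl | hw0
    · simp [form_zero_left]
    have h := isMinOn_iff.mp hmin _ (hnorm w hw hw0)
    simp only [form_smul_left, form_smul_right] at h
    have hi : ‖w‖⁻¹ ≠ 0 := inv_ne_zero (norm_ne_zero_iff.mpr hw0)
    rw [mul_div_mul_left _ _ hi, mul_div_mul_left _ _ hi] at h
    exact (le_div_iff₀ (form_pos hY hw0)).mp h
  have hvv : form X v v = c * form Y v v := by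
    rw [hc, div_mul_cancel₀ _ (form_pos hY hv0).ne']
  refine ⟨c, v, hv.1, hv0, hle, fun w hw => ?_⟩
  set b := form X w v - c * form Y w v with hb
  set d := form X w w - c * form Y w w with hd
  have hd0 : 0 ≤ d := by linarith [hle w hw]
  -- First variation: minimality along `v - t w` reads `t² d - 2 t b ≥ 0`. With `t = b / (d + 1)`,
  -- where the `+ 1` keeps the denominator positive, this becomes `-t² (d + 2) ≥ 0`, hence `b = 0`.
  have h := hle (v - (b / (d + 1)) • w) (W.sub_mem hv.1 (W.smul_mem _ hw))
  simp only [form_sub_left, form_sub_right, form_smul_left, form_smul_right] at h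
  rw [form_comm hX v w, form_comm (PosDef.transpose_eq hY) v w] at h
  set t := b / (d + 1) with ht
  have htb : t * (d + 1) = b := div_mul_cancel₀ _ (by positivity)
  have h1 : 0 ≤ t * (t * d) - 2 * (t * b) := by
    rw [hb, hd]
    linarith
  have h2 : t * t * (d + 2) ≤ 0 := by
    rw [← htb] at h1
    linarith
  have ht0 : t * t = 0 := by
    have := mul_self_nonneg t
    nlinarith
  have hb0 : b = 0 := by rw [← htb, mul_self_eq_zero.mp ht0, zero_mul]
  linarith

theorem mem_spectrum_iff {M : Matrix (Fin k) (Fin k) ℝ} {μ : ℝ} :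
    μ ∈ spectrum ℝ M ↔ ∃ v, v ≠ 0 ∧ M *ᵥ v = μ • v := by
  rw [spectrum.mem_iff, Matrix.isUnit_iff_isUnit_det, isUnit_iff_ne_zero, not_not,
    ← Matrix.exists_mulVec_eq_zero_iff]
  refine exists_congr fun v => and_congr_right fun _ => ?_
  rw [sub_mulVec, sub_eq_zero, Algebra.algebraMap_eq_smul_one, smul_mulVec, one_mulVec, eq_comm]

theorem eq_zero_of_forall_form (hA : A.PosDef) {x : Fin k → ℝ} (h : ∀ w, form A w x = 0) :
    x = 0 := eq_zero_of_form_nonpos hA (h x).le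

/-- `X * Z` is self-adjoint for the inner product of `Z`, and its Rayleigh quotient there is that of
`Z X Z` against `Z`. Used with `Z` a Galerkin matrix and `X` an inverse preconditioner. -/
theorem exists_isLeast_spectrum_mul {X Z : Matrix (Fin k) (Fin k) ℝ} (hk : 0 < k) (hX : Xᵀ = X)
    (hZ : Z.PosDef) : ∃ c, IsLeast (spectrum ℝ (X * Z)) c ∧
      ∀ y, c * form Z y y ≤ form X (Z *ᵥ y) (Z *ᵥ y) := by
  have hZt := PosDef.transpose_eq hZ
  have hform : ∀ x y, form (Z * X * Z) x y = form X (Z *ᵥ x) (Z *ᵥ y) := by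
    intro x y
    have := form_mulVec_mulVec (A := X) Z x y
    rwa [galerkin, hZt, eq_comm] at this
  have hform' : ∀ x y, form (Z * X * Z) x y = form Z x ((X * Z) *ᵥ y) := by
    intro x y
    simp only [form, mulVec_mulVec, Matrix.mul_assoc]
  obtain ⟨c, v, -, hv0, hle, heq⟩ := exists_rayleigh_min (X := Z * X * Z) (Y := Z)
    (by simp [transpose_mul, hZt, hX, Matrix.mul_assoc]) hZ ⊤
    (w₀ := fun _ => 1) Submodule.mem_top (fun h => by simpa using congrFun h ⟨0, hk⟩)
  refine ⟨c, ⟨mem_spectrum_iff.mpr ⟨v, hv0, ?_⟩, ?_⟩, fun y => ?_⟩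
  · refine sub_eq_zero.mp (eq_zero_of_forall_form hZ fun w => ?_)
    rw [form_sub_right, form_smul_right, ← hform', heq w Submodule.mem_top, sub_self]
  · rintro μ hμ
    obtain ⟨x, hx0, hx⟩ := mem_spectrum_iff.mp hμ
    have h := hle x Submodule.mem_top
    rw [hform', hx, form_smul_right] at h
    exact le_of_mul_le_mul_right h (form_pos hZ hx0)
  · rw [← hform]
    exact hle y Submodule.mem_top

theorem exists_isGreatest_spectrum_mul {X Z : Matrix (Fin k) (Fin k) ℝ} (hk : 0 < k)
    (hX : Xᵀ = X) (hZ : Z.PosDef) : ∃ c, IsGreatest (spectrum ℝ (X * Z)) c ∧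
      ∀ y, form X (Z *ᵥ y) (Z *ᵥ y) ≤ c * form Z y y := by
  obtain ⟨c, hc, h⟩ := exists_isLeast_spectrum_mul (X := -X) hk (by simp [hX]) hZ
  rw [Matrix.neg_mul, ← spectrum.neg_eq] at hc
  refine ⟨-c, ⟨hc.1, fun μ hμ => ?_⟩, fun y => ?_⟩
  · have := hc.2 (show -μ ∈ -spectrum ℝ (X * Z) by simpa using hμ)
    linarith
  · have := h y
    rw [form_neg_matrix] at this
    linarith

theorem pos_of_mem_spectrum_mul {X Z : Matrix (Fin k) (Fin k) ℝ} (hX : X.PosDef)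
    (hZ : Z.PosDef) {μ : ℝ} (hμ : μ ∈ spectrum ℝ (X * Z)) : 0 < μ := by
  obtain ⟨y, hy0, hy⟩ := mem_spectrum_iff.mp hμ
  have hZy : Z *ᵥ y ≠ 0 := by
    intro h
    have := form_pos hZ hy0
    simp [form, h] at this
  have h := form_pos hX hZy
  unfold form at h
  rw [mulVec_mulVec, hy, dotProduct_comm, smul_dotProduct, smul_eq_mul] at h
  exact pos_of_mul_pos_left h (form_nonneg hZ y)

end form

/-! ### Rank conditions as kernel conditions -/

section rank

theorem rank_eq_iff_ker {m k : ℕ} {M : Matrix (Fin m) (Fin k) ℝ} :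
    M.rank = k ↔ ∀ y, M *ᵥ y = 0 → y = 0 := by
  have h := LinearMap.finrank_range_add_finrank_ker M.mulVecLin
  rw [Module.finrank_fin_fun] at h
  have h1 : M.rank = k ↔ LinearMap.ker M.mulVecLin = ⊥ := by
    rw [← Submodule.finrank_eq_zero, Matrix.rank]
    omega
  rw [h1, LinearMap.ker_eq_bot']
  simp

theorem exists_mulVec_eq_zero_of_rank_lt {m k : ℕ} {M : Matrix (Fin m) (Fin k) ℝ}
    (h : M.rank < k) : ∃ y, y ≠ 0 ∧ M *ᵥ y = 0 := by
  by_contra! hne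
  refine h.ne (rank_eq_iff_ker.mpr fun y hy => ?_)
  by_contra h0
  exact hne y h0 hy

/-- The columns of `(S P)` span the whole space, and `x` is orthogonal to all of them, hence to
itself. -/
theorem eq_zero_of_rank_fromCols {n k l : ℕ} {S : Matrix (Fin n) (Fin k) ℝ}
    {P : Matrix (Fin n) (Fin l) ℝ} (h : (Matrix.fromCols S P).rank = n) {x : Fin n → ℝ}
    (hS : Sᵀ *ᵥ x = 0) (hP : Pᵀ *ᵥ x = 0) : x = 0 := by
  have h' : LinearMap.range (Matrix.fromCols S P).mulVecLin = ⊤ :=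
    Submodule.eq_top_of_finrank_eq (by rw [Module.finrank_fin_fun]; exact h)
  obtain ⟨y, hy⟩ := LinearMap.range_eq_top.mp h' x
  rw [Matrix.mulVecLin_apply] at hy
  have h2 : (Matrix.fromCols S P)ᵀ *ᵥ x = 0 := by
    rw [transpose_fromCols, fromRows_mulVec, hS, hP]
    ext i
    cases i <;> rfl
  refine dotProduct_self_eq_zero.mp ?_
  nth_rewrite 2 [← hy]
  rw [dotProduct_mulVec, ← mulVec_transpose, h2, zero_dotProduct]

end rank


/-! ### Energy norm and numerical radius -/

section opNorm

variable {n : ℕ} {A E : Matrix (Fin n) (Fin n) ℝ}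

theorem exists_isGreatest_energyQuotients (hA : A.PosDef) (hn : 0 < n)
    (E : Matrix (Fin n) (Fin n) ℝ) : ∃ c, IsGreatest (energyQuotients A E) c := by
  -- The sign turns the minimum of the Rayleigh quotient into the maximum of `‖E v‖² / ‖v‖²`.
  have hsym : (-galerkin A E)ᵀ = -galerkin A E := by
    simp [galerkin, transpose_mul, PosDef.transpose_eq hA, Matrix.mul_assoc]
  obtain ⟨c, v, -, hv0, hle, heq⟩ := exists_rayleigh_min hsym hA ⊤
    (w₀ := fun _ => 1) Submodule.mem_top (fun h => by simpa using congrFun h ⟨0, hn⟩)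
  simp only [form_neg_matrix, ← form_mulVec_mulVec] at hle heq
  refine ⟨_, ⟨v, hv0, rfl⟩, ?_⟩
  rintro q ⟨w, hw0, rfl⟩
  have hv := form_pos hA hv0
  have hw := form_pos hA hw0
  have h1 := hle w Submodule.mem_top
  have h2 := heq v Submodule.mem_top
  simp only [energyNorm, ← form.eq_1]
  rw [← Real.sqrt_div' _ hw.le, ← Real.sqrt_div' _ hv.le]
  refine Real.sqrt_le_sqrt ((div_le_iff₀ hw).mpr ?_)
  rw [show form A (E *ᵥ v) (E *ᵥ v) = -c * form A v v by linarith, mul_div_cancel_right₀ _ hv.ne']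
  linarith

/-- The energy norm of an `A`-self-adjoint matrix is bounded by its numerical radius. -/
theorem opNorm_le_of_abs_form_le (hA : A.PosDef) (hE : Eᵀ * A = A * E) {N u : ℝ}
    (hN : N ∈ energyQuotients A E)
    (h : ∀ v, |form A v (E *ᵥ v)| ≤ u * form A v v) : N ≤ u := by
  obtain ⟨v, hv0, rfl⟩ := hN
  have hv := form_pos hA hv0
  have hu : 0 ≤ u := nonneg_of_mul_nonneg_left ((abs_nonneg _).trans (h v)) hv
  have hAt := PosDef.transpose_eq hA
  simp only [energyNorm, ← form.eq_1]
  rw [← Real.sqrt_div' _ hv.le]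
  refine Real.sqrt_le_iff.mpr ⟨hu, (div_le_iff₀ hv).mpr ?_⟩
  -- Polarization: subtract the values of the form of `E` at `v ± t E v`, then apply the
  -- parallelogram law. The choice `t = 1 / u` below gives `‖E v‖² ≤ u² ‖v‖²`.
  have key : ∀ t : ℝ, 4 * (t * form A (E *ᵥ v) (E *ᵥ v)) ≤
      2 * u * (form A v v + t * t * form A (E *ᵥ v) (E *ᵥ v)) := by
    intro t
    have h1 := (abs_le.mp (h (v + t • E *ᵥ v))).2
    have h2 := (abs_le.mp (h (v - t • E *ᵥ v))).1
    simp only [mulVec_add, mulVec_sub, mulVec_smul, form_add_left, form_add_right, form_sub_left,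
      form_sub_right, form_smul_left, form_smul_right] at h1 h2
    rw [← form_mulVec_left hE v (E *ᵥ v)] at h1 h2
    rw [form_comm hAt v (E *ᵥ v)] at h1 h2
    linarith
  rcases hu.eq_or_lt with rfl | hu
  · have := key 1
    linarith [form_nonneg hA (E *ᵥ v)]
  · have := key u⁻¹
    have h3 := mul_le_mul_of_nonneg_left this hu.le
    have hi : u * u⁻¹ = 1 := mul_inv_cancel₀ hu.ne'
    set y := form A (E *ᵥ v) (E *ᵥ v)
    have e1 : u * (4 * (u⁻¹ * y)) = 4 * y := by linear_combination (4 * y) * hi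
    have e2 : u * (2 * u * (form A v v + u⁻¹ * u⁻¹ * y)) = 2 * u ^ 2 * form A v v + 2 * y := by
      linear_combination (2 * y * (u * u⁻¹ + 1)) * hi
    rw [e1, e2] at h3
    linarith

theorem nonneg_of_mem_energyQuotients {N : ℝ} (hN : N ∈ energyQuotients A E) : 0 ≤ N := by
  obtain ⟨v, -, rfl⟩ := hN
  exact div_nonneg (Real.sqrt_nonneg _) (Real.sqrt_nonneg _)

theorem abs_form_le_opNorm (hA : A.PosDef) {N : ℝ} (hN : IsGreatest (energyQuotients A E) N)
    (v : Fin n → ℝ) : |form A v (E *ᵥ v)| ≤ N * form A v v := by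
  rcases eq_or_ne v 0 with rfl | hv0
  · simp [form_zero_left]
  have hv := form_pos hA hv0
  have hN0 := nonneg_of_mem_energyQuotients hN.1
  have h := hN.2 ⟨v, hv0, rfl⟩
  simp only [energyNorm, ← form.eq_1] at h
  rw [← Real.sqrt_div' _ hv.le, Real.sqrt_le_left hN0, div_le_iff₀ hv] at h
  refine abs_le_of_sq_le_sq (le_trans (form_sq_le hA _ _) ?_) (by positivity)
  nlinarith

theorem le_opNorm_of_form (hA : A.PosDef) {N l : ℝ} (hN : IsGreatest (energyQuotients A E) N)
    {v : Fin n → ℝ} (hv : v ≠ 0) (h : l * form A v v ≤ |form A v (E *ᵥ v)|) : l ≤ N :=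
  le_of_mul_le_mul_right (h.trans (abs_form_le_opNorm hA hN v)) (form_pos hA hv)

end opNorm

/-! ### Smoothing followed by a projection -/

section smoothing

variable {n : ℕ} {A T T' D : Matrix (Fin n) (Fin n) ℝ}

theorem adjoint_symm (hA : Aᵀ = A) (hT : Tᵀ * A = A * T') : T'ᵀ * A = A * T := by
  have := congrArg transpose hT
  simpa [transpose_mul, hA, eq_comm] using this

theorem form_mulVec_self (hD : Dᵀ * A = A * D) (hDD : D * D = D)
    (x : Fin n → ℝ) : form A (D *ᵥ x) (D *ᵥ x) = form A x (D *ᵥ x) := by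
  rw [form_mulVec_left hD, mulVec_mulVec, hDD]

/-- A bound for `T* D` carries over to its adjoint `D T`. -/
theorem form_proj_mulVec_le (hA : A.PosDef) (hT : Tᵀ * A = A * T') (hD : Dᵀ * A = A * D)
    (hDD : D * D = D) {c : ℝ} (hc : 0 ≤ c)
    (h : ∀ x, form A (T' *ᵥ (D *ᵥ x)) (T' *ᵥ (D *ᵥ x)) ≤ c * form A (D *ᵥ x) (D *ᵥ x))
    (v : Fin n → ℝ) :
    form A (D *ᵥ (T *ᵥ v)) (D *ᵥ (T *ᵥ v)) ≤ c * form A v v := by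
  set y := D *ᵥ (T *ᵥ v) with hy
  -- `‖y‖² = (T' y, v)`; Cauchy–Schwarz and the hypothesis at `y = D T v` then allow division by
  -- `‖y‖²`.
  have hyy : form A y y = form A (T' *ᵥ y) v := by
    rw [form_mulVec_left (adjoint_symm (PosDef.transpose_eq hA) hT), hy, form_mulVec_self hD hDD,
      ← form_mulVec_left hD]
  have hcs := form_sq_le hA (T' *ᵥ y) v
  rw [← hyy] at hcs
  have h1 := h (T *ᵥ v)
  rw [← hy] at h1
  rcases (form_nonneg hA y).eq_or_lt with h0 | h0
  · rw [← h0]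
    exact mul_nonneg hc (form_nonneg hA v)
  · have h2 : form A y y ^ 2 ≤ c * form A y y * form A v v :=
      hcs.trans (mul_le_mul_of_nonneg_right h1 (form_nonneg hA v))
    nlinarith

theorem form_mul_adjoint (hA : Aᵀ = A) (hT : Tᵀ * A = A * T') {R : Matrix (Fin n) (Fin n) ℝ}
    (hR : T * T' = 1 - R) (x : Fin n → ℝ) :
    form A (T' *ᵥ x) (T' *ᵥ x) = form A x x - form A x (R *ᵥ x) := by
  rw [form_mulVec_left (adjoint_symm hA hT), mulVec_mulVec, hR, sub_mulVec, one_mulVec,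
    form_sub_right]

/-- For an `A`-orthogonal projection `D` and `T T* = 1 - R` with `R` definite on the range of `D`,
the squared energy norm of `D T` is `1 - c`, where `c` is the least positive eigenvalue
of `R D`. -/
theorem exists_isLeast_posSpectrum (hA : A.PosDef) (hT : Tᵀ * A = A * T') (hD : Dᵀ * A = A * D)
    (hDD : D * D = D) {R : Matrix (Fin n) (Fin n) ℝ} (hR : T * T' = 1 - R)
    (hpos : ∀ x, D *ᵥ x = x → x ≠ 0 → 0 < form A x (R *ᵥ x))
    (hne : ∃ x, x ≠ 0 ∧ D *ᵥ x = x) :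
    ∃ c, IsLeast (posSpectrum (R * D)) c ∧
      (∀ v, form A (D *ᵥ (T *ᵥ v)) (D *ᵥ (T *ᵥ v)) ≤ (1 - c) * form A v v) ∧
      ∃ v, v ≠ 0 ∧ (1 - c) * form A v v ≤ form A (D *ᵥ (T *ᵥ v)) (D *ᵥ (T *ᵥ v)) := by
  have hAt := PosDef.transpose_eq hA
  have hRsym : Rᵀ * A = A * R := by
    have h1 : R = 1 - T * T' := by rw [hR, sub_sub_cancel]
    rw [h1, transpose_sub, transpose_mul, transpose_one, Matrix.sub_mul, Matrix.mul_sub,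
      Matrix.mul_assoc, hT, ← Matrix.mul_assoc, adjoint_symm hAt hT, Matrix.one_mul,
      Matrix.mul_one, Matrix.mul_assoc]
  have hAR : ∀ x y, form (A * R) x y = form A x (R *ᵥ y) := by
    intro x y
    simp only [form, mulVec_mulVec]
  have hfix : ∀ x, x ∈ LinearMap.range D.mulVecLin ↔ D *ᵥ x = x := by
    intro x
    constructor
    · rintro ⟨y, rfl⟩
      rw [mulVecLin_apply, mulVec_mulVec, hDD]
    · intro h
      exact ⟨x, h⟩
  obtain ⟨x₀, hx₀, hDx₀⟩ := hne
  obtain ⟨c, x, hxW, hx0, hle, heq⟩ := exists_rayleigh_min (X := A * R)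
    (by rw [transpose_mul, hAt, hRsym]) hA (LinearMap.range D.mulVecLin) ((hfix x₀).mpr hDx₀) hx₀
  simp only [hAR] at hle heq
  have hDx := (hfix x).mp hxW
  have hq := form_pos hA hx0
  have heig : D *ᵥ (R *ᵥ x) = c • x := by
    refine sub_eq_zero.mp (eq_zero_of_forall_form hA fun w => ?_)
    -- Criticality holds only against the range of `D`; testing with `D w` for arbitrary `w` gives
    -- `D R x = c x`, so `R x` is an eigenvector of `R D`.
    have hw := heq _ ((hfix (D *ᵥ w)).mpr (by rw [mulVec_mulVec, hDD]))
    rw [form_mulVec_left hD, form_mulVec_left hD, hDx] at hw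
    rw [form_sub_right, form_smul_right, hw, sub_self]
  have hc0 : 0 < c := by
    have h1 := hpos x hDx hx0
    rw [heq x hxW] at h1
    exact pos_of_mul_pos_left h1 hq.le
  have hTx : form A (T' *ᵥ x) (T' *ᵥ x) = (1 - c) * form A x x := by
    rw [form_mul_adjoint hAt hT hR, heq x hxW]
    ring
  have hc1 : 0 ≤ 1 - c := by
    have h1 := form_nonneg hA (T' *ᵥ x)
    rw [hTx] at h1
    exact nonneg_of_mul_nonneg_left h1 hq
  refine ⟨c, ⟨⟨mem_spectrum_iff.mpr ⟨R *ᵥ x, ?_, ?_⟩, hc0⟩, ?_⟩, ?_, ?_⟩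
  · intro h
    have h1 := hpos x hDx hx0
    rw [h, form_zero_right] at h1
    exact h1.false
  · rw [← mulVec_mulVec, heig, mulVec_smul]
  · rintro μ ⟨hμ, hμ0⟩
    obtain ⟨y, hy0, hy⟩ := mem_spectrum_iff.mp hμ
    rw [← mulVec_mulVec] at hy
    have hDy0 : D *ᵥ y ≠ 0 := by
      intro h
      rw [h, mulVec_zero, eq_comm, smul_eq_zero] at hy
      exact hy.elim hμ0.ne' hy0
    have h1 := hle (D *ᵥ y) ⟨y, rfl⟩
    have h2 := form_mulVec_left hD (D *ᵥ y) y
    rw [mulVec_mulVec, hDD] at h2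
    rw [hy, form_smul_right, h2] at h1
    exact le_of_mul_le_mul_right h1 (form_pos hA hDy0)
  · refine form_proj_mulVec_le hA hT hD hDD hc1 fun y => ?_
    rw [form_mul_adjoint hAt hT hR]
    linarith [hle (D *ᵥ y) ⟨y, rfl⟩]
  -- The extremal vector is `T' x`, since `D T T' x = (1 - c) x`. It may vanish when `c = 1`, but
  -- then the bound is trivial.
  · rcases hc1.eq_or_lt with h1 | h1
    · refine ⟨x, hx0, ?_⟩
      rw [← h1, zero_mul]
      exact form_nonneg hA _
    · refine ⟨T' *ᵥ x, fun h => ?_, ?_⟩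
      · rw [h, form_zero_left] at hTx
        exact (mul_pos h1 hq).ne hTx
      · have h2 : D *ᵥ (T *ᵥ (T' *ᵥ x)) = (1 - c) • x := by
          rw [mulVec_mulVec _ T, hR, sub_mulVec, one_mulVec, mulVec_sub, hDx, heig, sub_smul,
            one_smul]
        rw [h2, hTx, form_smul_left, form_smul_right]

/-- If `T T* = 1 - R` with `R ≤ L` in the energy order, every nonzero vector is the
image under `T` of a vector whose energy is at most `1 / (1 - L)` times as large. -/
theorem exists_preimage (hA : A.PosDef) (hT : Tᵀ * A = A * T') {R : Matrix (Fin n) (Fin n) ℝ}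
    (hR : T * T' = 1 - R) {L : ℝ} (hL : L < 1)
    (hRL : ∀ x, form A x (R *ᵥ x) ≤ L * form A x x) {w : Fin n → ℝ} (hw : w ≠ 0) :
    ∃ v, v ≠ 0 ∧ T *ᵥ v = w ∧ (1 - L) * form A v v ≤ form A w w := by
  have hAt := PosDef.transpose_eq hA
  have hL' : 0 < 1 - L := by linarith
  have hlow : ∀ x, (1 - L) * form A x x ≤ form A (T' *ᵥ x) (T' *ᵥ x) := by
    intro x
    rw [form_mul_adjoint hAt hT hR]
    linarith [hRL x]
  have hadj : ∀ x y, form A (T' *ᵥ x) y = form A x (T *ᵥ y) :=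
    form_mulVec_left (adjoint_symm hAt hT)
  have hinj : Function.Injective (T * T').mulVecLin := by
    refine (injective_iff_map_eq_zero _).mpr fun x hx => eq_zero_of_form_nonpos hA ?_
    rw [mulVecLin_apply, ← mulVec_mulVec] at hx
    have h1 := hlow x
    rw [hadj, hx, form_zero_right] at h1
    exact nonpos_of_mul_nonpos_right h1 hL'
  obtain ⟨z, hz⟩ := LinearMap.surjective_of_injective hinj w
  rw [mulVecLin_apply, ← mulVec_mulVec] at hz
  have hv0 : T' *ᵥ z ≠ 0 := by
    intro h
    rw [h, mulVec_zero] at hz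
    exact hw hz.symm
  refine ⟨T' *ᵥ z, hv0, hz, ?_⟩
  have hvp := form_pos hA hv0
  have h1 := form_sq_le hA z w
  have h2 : form A (T' *ᵥ z) (T' *ᵥ z) = form A z w := by rw [hadj, hz]
  rw [← h2] at h1
  have h3 := hlow z
  have h4 := form_nonneg hA w
  refine le_of_mul_le_mul_left ?_ hvp
  calc _ = (1 - L) * form A (T' *ᵥ z) (T' *ᵥ z) ^ 2 := by ring
    _ ≤ (1 - L) * (form A z z * form A w w) := mul_le_mul_of_nonneg_left h1 hL'.le
    _ = (1 - L) * form A z z * form A w w := by ring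
    _ ≤ _ := mul_le_mul_of_nonneg_right h3 h4

end smoothing

/-! ### Galerkin matrices and coarse projections -/

section setup

variable {n k : ℕ} {A : Matrix (Fin n) (Fin n) ℝ} {X : Matrix (Fin n) (Fin k) ℝ}

theorem galerkin_posDef (hA : A.PosDef) (hX : X.rank = k) : (galerkin A X).PosDef := by
  have hAt := PosDef.transpose_eq hA
  refine Matrix.PosDef.of_dotProduct_mulVec_pos ?_ fun x hx => ?_
  · simp [IsHermitian, conjTranspose_eq_transpose_of_trivial, galerkin, hAt, Matrix.mul_assoc]
  · have h := form_pos hA fun h => hx (rank_eq_iff_ker.mp hX x h)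
    rw [form_mulVec_mulVec] at h
    simpa [form] using h

theorem galerkin_inv_mulVec (h : (galerkin A X).PosDef) (x : Fin k → ℝ) :
    galerkin A X *ᵥ ((galerkin A X)⁻¹ *ᵥ x) = x := by
  rw [mulVec_mulVec, Matrix.mul_nonsing_inv _ ((isUnit_iff_isUnit_det _).mp h.isUnit), one_mulVec]

theorem coarseProj_adjoint (hA : A.PosDef) (hX : X.rank = k) :
    (coarseProj A X)ᵀ * A = A * coarseProj A X := by
  have h := PosDef.transpose_eq (galerkin_posDef hA hX).inv
  simp only [coarseProj, transpose_mul, transpose_transpose, h, PosDef.transpose_eq hA,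
    Matrix.mul_assoc]

theorem coarseProj_mul_self (hA : A.PosDef) (hX : X.rank = k) :
    coarseProj A X * coarseProj A X = coarseProj A X := by
  have hu := (isUnit_iff_isUnit_det _).mp (galerkin_posDef hA hX).isUnit
  calc _ = X * ((galerkin A X)⁻¹ * galerkin A X) * (galerkin A X)⁻¹ * Xᵀ * A := by
        simp only [coarseProj, galerkin, Matrix.mul_assoc]
    _ = _ := by rw [Matrix.nonsing_inv_mul _ hu, Matrix.mul_one, coarseProj]

theorem coarseProj_mulVec_range (hA : A.PosDef) (hX : X.rank = k) (y : Fin k → ℝ) :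
    coarseProj A X *ᵥ (X *ᵥ y) = X *ᵥ y := by
  have hu := (isUnit_iff_isUnit_det _).mp (galerkin_posDef hA hX).isUnit
  rw [mulVec_mulVec]
  congr 1
  calc _ = X * ((galerkin A X)⁻¹ * galerkin A X) := by
        simp only [coarseProj, galerkin, Matrix.mul_assoc]
    _ = _ := by rw [Matrix.nonsing_inv_mul _ hu, Matrix.mul_one]

theorem exists_of_coarseProj_mulVec_eq {x : Fin n → ℝ} (h : coarseProj A X *ᵥ x = x) :
    ∃ y, x = X *ᵥ y := by
  refine ⟨((galerkin A X)⁻¹ * Xᵀ * A) *ᵥ x, ?_⟩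
  rw [mulVec_mulVec]
  simpa only [coarseProj, Matrix.mul_assoc] using h.symm

theorem coarseProj_mulVec_eq_zero_iff (hA : A.PosDef) (hX : X.rank = k) {x : Fin n → ℝ} :
    coarseProj A X *ᵥ x = 0 ↔ (Xᵀ * A) *ᵥ x = 0 := by
  have h : coarseProj A X *ᵥ x = X *ᵥ ((galerkin A X)⁻¹ *ᵥ ((Xᵀ * A) *ᵥ x)) := by
    simp only [coarseProj, mulVec_mulVec, Matrix.mul_assoc]
  rw [h]
  constructor
  · intro h0
    have h1 := rank_eq_iff_ker.mp hX _ h0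
    rw [← galerkin_inv_mulVec (galerkin_posDef hA hX) ((Xᵀ * A) *ᵥ x), h1, mulVec_zero]
  · intro h0
    simp [h0]

theorem form_coarseProj_le (hA : A.PosDef) (hX : X.rank = k) (x : Fin n → ℝ) :
    form A x (coarseProj A X *ᵥ x) ≤ form A x x := by
  have hD := coarseProj_adjoint hA hX
  have h := form_nonneg hA (x - coarseProj A X *ᵥ x)
  rw [form_sub_left, form_sub_right, form_sub_right,
    form_mulVec_self hD (coarseProj_mul_self hA hX), form_mulVec_left hD x x] at h
  linarith

/-- Comparison of `X M Xᵀ A` with the `A`-orthogonal projection onto the range of `X`. -/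
theorem exists_form_sandwich_eq (hA : A.PosDef) (hX : X.rank = k) (M : Matrix (Fin k) (Fin k) ℝ)
    (x : Fin n → ℝ) : ∃ y, form A x (coarseProj A X *ᵥ x) = form (galerkin A X) y y ∧
      form A x ((X * M * Xᵀ * A) *ᵥ x) =
        form M (galerkin A X *ᵥ y) (galerkin A X *ᵥ y) := by
  have hG := galerkin_posDef hA hX
  have hAt := PosDef.transpose_eq hA
  -- The witness is the coefficient vector of the projection of `x` with respect to the columns of
  -- `X`.
  refine ⟨(galerkin A X)⁻¹ *ᵥ ((Xᵀ * A) *ᵥ x), ?_, ?_⟩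
  · rw [coarseProj, form_sandwich hAt]
    unfold form
    rw [galerkin_inv_mulVec hG, dotProduct_comm]
  · rw [form_sandwich hAt, galerkin_inv_mulVec hG]

end setup

/-! ### The symmetrized smoother -/

section smoother

variable {n k : ℕ} {A : Matrix (Fin n) (Fin n) ℝ} {S : Matrix (Fin n) (Fin k) ℝ}
  {M : Matrix (Fin k) (Fin k) ℝ}

theorem smoother_inv (hMA : (M + Mᵀ - galerkin A S).PosDef) :
    (smoother A S M)⁻¹ = M⁻¹ * (M + Mᵀ - galerkin A S) * (M⁻¹)ᵀ := by
  have hu := (isUnit_iff_isUnit_det _).mp hMA.isUnit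
  rw [smoother, Matrix.mul_inv_rev, Matrix.mul_inv_rev, Matrix.nonsing_inv_nonsing_inv _ hu,
    transpose_nonsing_inv, Matrix.mul_assoc]

/-- This expanded form is what multiplying out `T T'` produces, the inner factor `Sᵀ A S` being the
Galerkin matrix. -/
theorem smoother_inv_eq (hM : IsUnit M) (hMA : (M + Mᵀ - galerkin A S).PosDef) :
    (smoother A S M)⁻¹ = (M⁻¹)ᵀ + M⁻¹ - M⁻¹ * galerkin A S * (M⁻¹)ᵀ := by
  have hu := (isUnit_iff_isUnit_det _).mp hM
  have h1 : Mᵀ * (M⁻¹)ᵀ = 1 := by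
    rw [← transpose_mul, Matrix.nonsing_inv_mul _ hu, transpose_one]
  rw [smoother_inv hMA, Matrix.mul_sub, Matrix.mul_add, Matrix.nonsing_inv_mul _ hu,
    Matrix.sub_mul, Matrix.add_mul, Matrix.one_mul, Matrix.mul_assoc _ Mᵀ, h1, Matrix.mul_one]

theorem smoother_inv_posDef (hM : IsUnit M) (hMA : (M + Mᵀ - galerkin A S).PosDef) :
    (smoother A S M)⁻¹.PosDef := by
  have hu := (isUnit_iff_isUnit_det _).mp hM
  refine Matrix.PosDef.of_dotProduct_mulVec_pos ?_ fun x hx => ?_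
  · have h := PosDef.transpose_eq hMA
    rw [smoother_inv hMA]
    simp only [IsHermitian, conjTranspose_eq_transpose_of_trivial, transpose_mul, h,
      transpose_transpose, Matrix.mul_assoc]
  · have h0 : (M⁻¹)ᵀ *ᵥ x ≠ 0 := by
      intro h
      have h1 : Mᵀ * (M⁻¹)ᵀ = 1 := by
        rw [← transpose_mul, Matrix.nonsing_inv_mul _ hu, transpose_one]
      apply hx
      rw [← one_mulVec x, ← h1, ← mulVec_mulVec, h, mulVec_zero]
    have h := form_pos hMA h0
    rw [form_mulVec_mulVec, galerkin, transpose_transpose, ← smoother_inv hMA] at h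
    simpa [form] using h

theorem smoothing_adjoint (hA : Aᵀ = A) :
    (1 - S * M⁻¹ * Sᵀ * A)ᵀ * A = A * (1 - S * (M⁻¹)ᵀ * Sᵀ * A) := by
  simp only [transpose_sub, transpose_mul, transpose_one, transpose_transpose, hA, Matrix.sub_mul,
    Matrix.mul_sub, Matrix.one_mul, Matrix.mul_one, Matrix.mul_assoc]

theorem smoothing_mul_adjoint (hM : IsUnit M) (hMA : (M + Mᵀ - galerkin A S).PosDef) :
    (1 - S * M⁻¹ * Sᵀ * A) * (1 - S * (M⁻¹)ᵀ * Sᵀ * A) = 1 - smoothOp A S M := by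
  rw [smoothOp, smoother_inv_eq hM hMA]
  simp only [galerkin, Matrix.mul_sub, Matrix.sub_mul, Matrix.mul_add, Matrix.add_mul,
    Matrix.one_mul, Matrix.mul_one, Matrix.mul_assoc]
  abel

theorem form_smoothOp (hA : Aᵀ = A) (x : Fin n → ℝ) : form A x (smoothOp A S M *ᵥ x) =
    form (smoother A S M)⁻¹ ((Sᵀ * A) *ᵥ x) ((Sᵀ * A) *ᵥ x) := by
  rw [smoothOp, form_sandwich hA]

end smoother


/-! ### Scalar inequalities behind the bounds -/

/-- The eigenvalue bounds for a two-level method, in terms of the energies `q` of the initial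
error, `t` after smoothing, `p` of the coarse part of the latter, and `k` removed by the
coarse correction. -/
theorem two_level_bounds {V : Type*} [Zero V] {q t p k : V → ℝ} {α β σ Λ κ N : ℝ}
    (hα : 0 < α) (hαβ : α ≤ β) (hN : 0 ≤ N)
    (up : ∀ u, (∀ v, |t v - k v| ≤ u * q v) → N ≤ u)
    (low : ∀ l v, v ≠ 0 → l * q v ≤ |t v - k v| → l ≤ N)
    (hq : ∀ v, 0 ≤ q v) (hp : ∀ v, 0 ≤ p v) (hpt : ∀ v, p v ≤ t v) (htq : ∀ v, t v ≤ q v)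
    (hαk : ∀ v, α * p v ≤ k v) (hkβ : ∀ v, k v ≤ β * p v)
    (hσ : ∀ v, t v - p v ≤ (1 - σ) * q v) (hκ : ∀ v, p v ≤ (1 - κ) * q v)
    (ht' : ∃ v, v ≠ 0 ∧ t v = q v)
    (hσ' : ∃ v, v ≠ 0 ∧ (1 - σ) * q v ≤ t v - p v)
    (hκ' : ∃ v, v ≠ 0 ∧ (1 - κ) * q v ≤ p v)
    (hΛ₀ : Λ < 1 → ∃ v, v ≠ 0 ∧ p v = 0 ∧ (1 - Λ) * q v ≤ t v)
    (hΛ₁ : Λ < 1 → ∃ v, v ≠ 0 ∧ p v = t v ∧ (1 - Λ) * q v ≤ t v) :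
    (β ≤ 1 → 1 - min (β - β * κ) σ ≤ N ∧ N ≤ 1 - α * σ) ∧
    (α ≤ 1 ∧ 1 < β → 1 - min Λ (β * σ) ≤ N ∧ N ≤ max (1 - α * σ) ((β - 1) * (1 - κ))) ∧
    (1 < α →
      max (max (α - 1 - α * κ) (1 - Λ)) (max ((α - 1) * (1 - Λ)) (1 - β * σ)) ≤ N ∧
      N ≤ max (1 - σ) ((β - 1) * (1 - κ))) := by
  have hβ : 0 < β := hα.trans_le hαβ
  -- `t - α p = (1 - α) t + α (t - p)`.
  have upper : α ≤ 1 → ∀ v, t v - k v ≤ (1 - α * σ) * q v := by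
    intro hα1 v
    have h1 := mul_le_mul_of_nonneg_left (htq v) (sub_nonneg.mpr hα1)
    have h2 := mul_le_mul_of_nonneg_left (hσ v) hα.le
    linarith [hαk v]
  have lower : 1 < β → ∀ v, k v - t v ≤ (β - 1) * (1 - κ) * q v := by
    intro hβ1 v
    have h1 := mul_le_mul_of_nonneg_left (hκ v) (sub_nonneg.mpr hβ1.le)
    linarith [hkβ v, hpt v]
  have smooth : 1 - Λ ≤ N := by
    rcases lt_or_ge Λ 1 with h | h
    · obtain ⟨v, hv, hp0, hle⟩ := hΛ₀ h
      refine low _ v hv (hle.trans (le_trans ?_ (le_abs_self _)))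
      have := hkβ v
      rw [hp0, mul_zero] at this
      linarith
    · linarith
  -- `t - β p = β (t - p) - (β - 1) t`, evaluated where `t - p` is extremal.
  have coarse : 1 < β → 1 - β * σ ≤ N := by
    intro hβ1
    obtain ⟨v, hv, hle⟩ := hσ'
    refine low _ v hv (le_trans ?_ (le_abs_self _))
    have h1 := mul_le_mul_of_nonneg_left (htq v) (sub_nonneg.mpr hβ1.le)
    have h2 := mul_le_mul_of_nonneg_left hle hβ.le
    linarith [hkβ v]
  have max_bound : ∀ a b, (∀ v, t v - k v ≤ a * q v) → (∀ v, k v - t v ≤ b * q v) →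
      N ≤ max a b := by
    intro a b ha hb
    refine up _ fun v => abs_le'.mpr ⟨(ha v).trans ?_, ?_⟩
    · exact mul_le_mul_of_nonneg_right (le_max_left _ _) (hq v)
    · rw [neg_sub]
      exact (hb v).trans (mul_le_mul_of_nonneg_right (le_max_right _ _) (hq v))
  refine ⟨fun hβ1 => ⟨?_, ?_⟩, fun ⟨hα1, hβ1⟩ => ⟨?_, ?_⟩, fun hα1 => ⟨?_, ?_⟩⟩
  · rw [sub_le_comm, le_min_iff, sub_le_comm, sub_le_comm (c := σ)]
    constructor
    · obtain ⟨v, hv, htv⟩ := ht'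
      refine low _ v hv (le_trans ?_ (le_abs_self _))
      have h1 := mul_le_mul_of_nonneg_left (hκ v) hβ.le
      linarith [hkβ v]
    · obtain ⟨v, hv, hle⟩ := hσ'
      refine low _ v hv (le_trans ?_ (le_abs_self _))
      have h1 := mul_le_mul_of_nonneg_right hβ1 (hp v)
      linarith [hkβ v]
  · refine up _ fun v => ?_
    have h1 := mul_le_mul_of_nonneg_right hβ1 (hp v)
    rw [abs_of_nonneg (by linarith [hkβ v, hpt v])]
    exact upper (hαβ.trans hβ1) v
  · rw [sub_le_comm, le_min_iff, sub_le_comm, sub_le_comm (c := β * σ)]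
    exact ⟨smooth, coarse hβ1⟩
  · exact max_bound _ _ (upper hα1) (lower hβ1)
  · refine max_le (max_le ?_ smooth) (max_le ?_ (coarse (hα1.trans_le hαβ)))
    · obtain ⟨v, hv, hle⟩ := hκ'
      refine low _ v hv (le_trans ?_ (neg_le_abs _))
      have h1 := mul_le_mul_of_nonneg_left hle hα.le
      linarith [hαk v, htq v]
    · rcases lt_or_ge Λ 1 with h | h
      · obtain ⟨v, hv, hpv, hle⟩ := hΛ₁ h
        refine low _ v hv (le_trans ?_ (neg_le_abs _))
        have h1 := mul_le_mul_of_nonneg_left hle (sub_nonneg.mpr hα1.le)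
        have h2 := hαk v
        rw [hpv] at h2
        linarith
      · exact (mul_nonpos_of_nonneg_of_nonpos (by linarith) (by linarith)).trans hN
  · refine max_bound _ _ (fun v => ?_) (lower (hα1.trans_le hαβ))
    have h1 := mul_le_mul_of_nonneg_right hα1.le (hp v)
    linarith [hαk v, hσ v]

end TLHB

/-! ### Assembly of the theorem -/

theorem theorem4p1 {n ns nc : ℕ}
    (hns : ns < n) (hnc : nc < n) (hn : n ≤ ns + nc)
    (A : Matrix (Fin n) (Fin n) ℝ) (hA : A.PosDef)
    (S : Matrix (Fin n) (Fin ns) ℝ) (hS : S.rank = ns)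
    (P : Matrix (Fin n) (Fin nc) ℝ) (hP : P.rank = nc)
    (hSP : (Matrix.fromCols S P).rank = n)
    (Ms : Matrix (Fin ns) (Fin ns) ℝ) (hMs : IsUnit Ms)
    (hMsA : (Ms + Msᵀ - TLHB.galerkin A S).PosDef)
    (Bc : Matrix (Fin nc) (Fin nc) ℝ) (hBc : Bc.PosDef)
    (α β σ Λ κ N : ℝ)
    (hα : α = TLHB.lamMin (Bc⁻¹ * TLHB.galerkin A P))
    (hβ : β = TLHB.lamMax (Bc⁻¹ * TLHB.galerkin A P))
    (hσ : σ = TLHB.lamMinPos (TLHB.smoothOp A S Ms * (1 - TLHB.coarseProj A P)))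
    (hΛ : Λ = TLHB.lamMax ((TLHB.smoother A S Ms)⁻¹ * TLHB.galerkin A S))
    (hκ : κ = TLHB.lamMinPos (TLHB.smoothOp A S Ms * TLHB.coarseProj A P))
    (hN : N = TLHB.energyOpNorm A (TLHB.iterMatrix A S P Ms Bc)) :
    -- all the extremal quantities are attained
    (IsLeast (spectrum ℝ (Bc⁻¹ * TLHB.galerkin A P)) α ∧
      IsGreatest (spectrum ℝ (Bc⁻¹ * TLHB.galerkin A P)) β ∧
      IsLeast (TLHB.posSpectrum (TLHB.smoothOp A S Ms * (1 - TLHB.coarseProj A P))) σ ∧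
      IsGreatest (spectrum ℝ ((TLHB.smoother A S Ms)⁻¹ * TLHB.galerkin A S)) Λ ∧
      IsGreatest (TLHB.energyQuotients A (TLHB.iterMatrix A S P Ms Bc)) N) ∧
    -- full rank case
    ((Sᵀ * A * P).rank = nc →
      IsLeast (TLHB.posSpectrum (TLHB.smoothOp A S Ms * TLHB.coarseProj A P)) κ ∧
      (β ≤ 1 →
        1 - min (β - β * κ) σ ≤ N ∧
        N ≤ 1 - α * σ) ∧
      (α ≤ 1 ∧ 1 < β →
        1 - min Λ (β * σ) ≤ N ∧
        N ≤ max (1 - α * σ) ((β - 1) * (1 - κ))) ∧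
      (1 < α →
        max (max (α - 1 - α * κ) (1 - Λ)) (max ((α - 1) * (1 - Λ)) (1 - β * σ)) ≤ N ∧
        N ≤ max (1 - σ) ((β - 1) * (1 - κ)))) ∧
    -- rank deficient case
    ((Sᵀ * A * P).rank < nc →
      (β ≤ 1 →
        1 - min β σ ≤ N ∧
        N ≤ 1 - α * σ) ∧
      (α ≤ 1 ∧ 1 < β →
        1 - min Λ (β * σ) ≤ N ∧
        N ≤ max (1 - α * σ) (β - 1)) ∧
      (1 < α →
        max (α - 1) (max (1 - Λ) (1 - β * σ)) ≤ N ∧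
        N ≤ max (1 - σ) (β - 1))) := by
  open TLHB in
  have hn0 : 0 < n := by omega
  have hns0 : 0 < ns := by omega
  have hnc0 : 0 < nc := by omega
  have hAt := PosDef.transpose_eq hA
  have hAc := galerkin_posDef hA hP
  have hAs := galerkin_posDef hA hS
  have hsm := smoother_inv_posDef hMs hMsA
  have hBi := hBc.inv
  -- the extremal eigenvalues of the pencils
  obtain ⟨a, ha, hale⟩ := exists_isLeast_spectrum_mul hnc0 (PosDef.transpose_eq hBi) hAc
  obtain ⟨b, hb, hleb⟩ := exists_isGreatest_spectrum_mul hnc0 (PosDef.transpose_eq hBi) hAc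
  obtain ⟨L, hL, hleL⟩ := exists_isGreatest_spectrum_mul hns0 (PosDef.transpose_eq hsm) hAs
  obtain ⟨c, hc⟩ := exists_isGreatest_energyQuotients hA hn0 (iterMatrix A S P Ms Bc)
  -- The extrema are attained, so the `sInf` and `sSup` in the definitions are genuine eigenvalues
  -- and not default values.
  obtain rfl : α = a := hα.trans ha.csInf_eq
  obtain rfl : β = b := hβ.trans hb.csSup_eq
  obtain rfl : Λ = L := hΛ.trans hL.csSup_eq
  obtain rfl : N = c := hN.trans hc.csSup_eq
  have hα0 := pos_of_mem_spectrum_mul hBi hAc ha.1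
  have hΛ0 := pos_of_mem_spectrum_mul hsm hAs hL.1
  -- the smoother
  set T := 1 - S * Ms⁻¹ * Sᵀ * A with hTdef
  set T' := 1 - S * (Ms⁻¹)ᵀ * Sᵀ * A
  set Q := coarseProj A P with hQdef
  have hT : Tᵀ * A = A * T' := smoothing_adjoint hAt
  have hR : T * T' = 1 - smoothOp A S Ms := smoothing_mul_adjoint hMs hMsA
  have hQ : Qᵀ * A = A * Q := coarseProj_adjoint hA hP
  have hQQ : Q * Q = Q := coarseProj_mul_self hA hP
  have hQ' : (1 - Q)ᵀ * A = A * (1 - Q) := by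
    rw [transpose_sub, transpose_one, Matrix.sub_mul, Matrix.mul_sub, hQ, Matrix.one_mul,
      Matrix.mul_one]
  have hQQ' : (1 - Q) * (1 - Q) = 1 - Q := by
    simp [Matrix.sub_mul, Matrix.mul_sub, hQQ]
  have hRpos : ∀ x, (Sᵀ * A) *ᵥ x ≠ 0 → 0 < form A x (smoothOp A S Ms *ᵥ x) := by
    intro x hx
    rw [form_smoothOp hAt]
    exact form_pos hsm hx
  have hRnonneg : ∀ x, 0 ≤ form A x (smoothOp A S Ms *ᵥ x) := by
    intro x
    rw [form_smoothOp hAt]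
    exact form_nonneg hsm _
  have hRle : ∀ x, form A x (smoothOp A S Ms *ᵥ x) ≤ Λ * form A x x := by
    intro x
    obtain ⟨y, h1, h2⟩ := exists_form_sandwich_eq hA hS (smoother A S Ms)⁻¹ x
    rw [smoothOp, h2]
    refine (hleL y).trans (mul_le_mul_of_nonneg_left ?_ hΛ0.le)
    rw [← h1]
    exact form_coarseProj_le hA hS x
  have hfix' : ∀ x, (1 - Q) *ᵥ x = x ↔ (Pᵀ * A) *ᵥ x = 0 := by
    intro x
    rw [sub_mulVec, one_mulVec, sub_eq_self, hQdef, coarseProj_mulVec_eq_zero_iff hA hP]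
  have hker : ∀ x, (Sᵀ * A) *ᵥ x = 0 → (Pᵀ * A) *ᵥ x = 0 → x = 0 := by
    intro x h1 h2
    rw [← mulVec_mulVec] at h1 h2
    have h3 := eq_zero_of_rank_fromCols hSP h1 h2
    refine eq_zero_of_form_nonpos hA ?_
    simp [form, h3]
  -- `w₀` lies in the kernel of `Q` and `z₀` is fixed by `T`; they exist because `nc < n` and `ns <
  -- n`.
  obtain ⟨w₀, hw₀, hw₀'⟩ := exists_mulVec_eq_zero_of_rank_lt
    ((Matrix.rank_le_height (Pᵀ * A)).trans_lt hnc)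
  obtain ⟨z₀, hz₀, hz₀'⟩ := exists_mulVec_eq_zero_of_rank_lt
    ((Matrix.rank_le_height (Sᵀ * A)).trans_lt hns)
  obtain ⟨y₀, hy₀⟩ : ∃ y : Fin nc → ℝ, P *ᵥ y ≠ 0 :=
    ⟨fun _ => 1, fun h => by simpa using congrFun (rank_eq_iff_ker.mp hP _ h) ⟨0, hnc0⟩⟩
  obtain ⟨s, hs, hsle, hsatt⟩ := exists_isLeast_posSpectrum hA hT hQ' hQQ' hR
    (fun x hx hx0 => hRpos x fun h => hx0 (hker x h ((hfix' x).mp hx)))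
    ⟨w₀, hw₀, (hfix' w₀).mpr hw₀'⟩
  obtain rfl : σ = s := hσ.trans hs.csInf_eq
  -- the energies
  have hval : ∀ v, form A v (iterMatrix A S P Ms Bc *ᵥ v) = form A (T *ᵥ v) (T *ᵥ v) -
      form A (T *ᵥ v) ((P * Bc⁻¹ * Pᵀ * A) *ᵥ (T *ᵥ v)) := by
    intro v
    rw [iterMatrix, ← mulVec_mulVec, ← mulVec_mulVec, ← form_mulVec_left hT, ← hTdef,
      sub_mulVec 1 (P * Bc⁻¹ * Pᵀ * A), one_mulVec, form_sub_right]
  have hEadj : (iterMatrix A S P Ms Bc)ᵀ * A = A * iterMatrix A S P Ms Bc := by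
    simp only [iterMatrix, transpose_mul, transpose_sub, transpose_one, transpose_transpose, hAt,
      PosDef.transpose_eq hBi, Matrix.mul_sub, Matrix.sub_mul, Matrix.mul_one, Matrix.one_mul,
      Matrix.mul_assoc]
    abel
  have hsplit : ∀ x, form A ((1 - Q) *ᵥ x) ((1 - Q) *ᵥ x) =
      form A x x - form A x (Q *ᵥ x) := by
    intro x
    rw [form_mulVec_self hQ' hQQ', sub_mulVec, one_mulVec, form_sub_right]
  have htq : ∀ v, form A (T *ᵥ v) (T *ᵥ v) ≤ 1 * form A v v := by
    intro v
    -- `R ≥ 0` makes `T'` a contraction; `D = 1` transfers this to `T`.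
    have h := form_proj_mulVec_le hA hT (D := 1) (by simp) (by simp) zero_le_one
      (fun x => by
        rw [one_mulVec, form_mul_adjoint hAt hT hR]
        linarith [hRnonneg x]) v
    rwa [one_mulVec] at h
  have hfixT : ∀ x, (Sᵀ * A) *ᵥ x = 0 → T *ᵥ x = x := by
    intro x hx
    rw [hTdef, sub_mulVec, one_mulVec, Matrix.mul_assoc, ← mulVec_mulVec, hx, mulVec_zero,
      sub_zero]
  -- `κ'` stays free: it is `κ` at full rank and 0 otherwise.
  have main : ∀ κ' : ℝ,
      (∀ v, form A (Q *ᵥ (T *ᵥ v)) (Q *ᵥ (T *ᵥ v)) ≤ (1 - κ') * form A v v) →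
      (∃ v, v ≠ 0 ∧ (1 - κ') * form A v v ≤ form A (Q *ᵥ (T *ᵥ v)) (Q *ᵥ (T *ᵥ v))) → _ :=
    fun κ' h1 h2 => two_level_bounds (V := Fin n → ℝ) (q := fun v => form A v v)
      (t := fun v => form A (T *ᵥ v) (T *ᵥ v))
      (p := fun v => form A (Q *ᵥ (T *ᵥ v)) (Q *ᵥ (T *ᵥ v)))
      (k := fun v => form A (T *ᵥ v) ((P * Bc⁻¹ * Pᵀ * A) *ᵥ (T *ᵥ v)))
      (α := α) (β := β) (σ := σ) (Λ := Λ) (κ := κ') (N := N)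
      hα0 (hb.2 ha.1) (nonneg_of_mem_energyQuotients hc.1)
      (fun u hu => opNorm_le_of_abs_form_le hA hEadj hc.1 fun v => by
        rw [hval]
        exact hu v)
      (fun l v hv hl => le_opNorm_of_form hA hc hv (by
        rw [hval]
        exact hl))
      (fun v => form_nonneg hA v) (fun v => form_nonneg hA _)
      (fun v => by
        rw [form_mulVec_self hQ hQQ]
        exact form_coarseProj_le hA hP _)
      (fun v => by simpa using htq v)
      (fun v => by
        obtain ⟨y, e1, e2⟩ := exists_form_sandwich_eq hA hP Bc⁻¹ (T *ᵥ v)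
        rw [form_mulVec_self hQ hQQ, hQdef, e1, e2]
        exact hale y)
      (fun v => by
        obtain ⟨y, e1, e2⟩ := exists_form_sandwich_eq hA hP Bc⁻¹ (T *ᵥ v)
        rw [form_mulVec_self hQ hQQ, hQdef, e1, e2]
        exact hleb y)
      (fun v => by
        have h := hsle v
        rwa [hsplit, ← form_mulVec_self hQ hQQ] at h)
      h1
      ⟨z₀, hz₀, by rw [hfixT z₀ hz₀']⟩
      (by
        obtain ⟨v, hv, h⟩ := hsatt
        rw [hsplit, ← form_mulVec_self hQ hQQ] at h
        exact ⟨v, hv, h⟩)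
      h2
      (fun hΛ1 => by
        obtain ⟨v, hv, hTv, h⟩ := exists_preimage hA hT hR hΛ1 hRle hw₀
        refine ⟨v, hv, ?_, by rw [hTv]; exact h⟩
        rw [hTv, hQdef, (coarseProj_mulVec_eq_zero_iff hA hP).mpr hw₀', form_zero_left])
      (fun hΛ1 => by
        obtain ⟨v, hv, hTv, h⟩ := exists_preimage hA hT hR hΛ1 hRle hy₀
        refine ⟨v, hv, ?_, by rw [hTv]; exact h⟩
        rw [hTv, hQdef, coarseProj_mulVec_range hA hP])
  refine ⟨⟨ha, hb, hs, hL, hc⟩, fun hrank => ?_, fun hrank => ?_⟩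
  -- Full rank makes `Sᵀ A P` injective, so `R` is definite on the range of `P`.
  · obtain ⟨d, hd, hdle, hdatt⟩ := exists_isLeast_posSpectrum hA hT hQ hQQ hR
      (fun x hx hx0 => hRpos x fun h => by
        obtain ⟨y, rfl⟩ := exists_of_coarseProj_mulVec_eq hx
        rw [mulVec_mulVec] at h
        rw [rank_eq_iff_ker.mp hrank y h, mulVec_zero] at hx0
        exact hx0 rfl)
      ⟨_, hy₀, coarseProj_mulVec_range hA hP y₀⟩
    obtain rfl : κ = d := hκ.trans hd.csInf_eq
    exact ⟨hd, main κ hdle hdatt⟩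
  · obtain ⟨y, hy0, hy⟩ := exists_mulVec_eq_zero_of_rank_lt hrank
    rw [← mulVec_mulVec] at hy
    -- `P y` is fixed by both `T` and `Q`, so `‖Q T‖ = 1` is attained there.
    have h := main 0
      (fun v => by
        rw [form_mulVec_self hQ hQQ, sub_zero]
        exact (form_coarseProj_le hA hP _).trans (htq v))
      ⟨P *ᵥ y, fun h => hy0 (rank_eq_iff_ker.mp hP y h), by
        rw [hfixT _ hy, hQdef, coarseProj_mulVec_range hA hP, sub_zero, one_mul]⟩
    simp only [mul_zero, sub_zero, mul_one] at h
    refine ⟨h.1, h.2.1, fun hα1 => ⟨?_, (h.2.2 hα1).2⟩⟩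
    have h3 := (h.2.2 hα1).1
    simp only [max_le_iff] at h3 ⊢
    exact ⟨h3.1.1, h3.1.2, h3.2.2⟩
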